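/- Let $T>0$, let $(W_t)$ be a real Brownian motion on a probability space $(\Omega,\mathcal F,\mathrm P)$ with its natural filtration (completed by the $\mathrm P$-null sets), let $y^0,\delta\in\mathbb R$ and $\rho>0$. Let $b_y',b_u',m:[0,T]\to\mathbb R$ be deterministic, with $b_y',b_u'$ measurable and bounded and $m$ integrable, and let $\sigma=\sigma(y,u)$ be continuously differentiable on $\mathbb R^2$ with bounded partial derivatives. For $u\in L^2([0,T];\mathbb R)$ let $y^u\in L^2_{\mathcal F}([0,T]\times\Omega;\mathbb R)$ be the solution on $[0,T]$ of the state equation $$dy^u_t=\big(b_y'(t)\,y^u_t+b_u'(t)\,u(t)+m(t)\big)\,dt+\sigma(y^u_t,u(t))\,dW_t,\qquad y^u_0=y^0 .$$ Let $\psi,\varphi$ be the solutions on $[0,T]$ of $$-\psi'(t)=1+b_y'(t)\psi(t),\quad \psi(T)=0,\qquad\qquad \varphi'(t)=b_y'(t)\varphi(t)+(b_u'(t))^2\psi(t),\quad \varphi(0)=0$$ (in the integrated sense), and for $w\in L^2([0,T];\mathbb R)$ put $$\mu(w)=\frac{\max\big\{\mathbb E\big[\int_0^T y^w_t\,dt\big]-\delta,\,0\big\}}{\rho\int_0^T\varphi(t)\,dt},\qquad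 \mathbb P w=w-\rho\,\mu(w)\,\psi\,b_u' ,$$ with the convention $\mu(w)=0$ if $\int_0^T\varphi(t)\,dt=0$. (This $\mathbb P$ is the explicit form of the projection onto the feasible control set $U(\delta)=\{u\in L^2([0,T];\mathbb R):\int_0^T\mathbb E[y^u_t]\,dt\le\delta\}$ when $\int_0^T\varphi(t)\,dt\neq 0$.) Then for all $w,z\in L^2([0,T];\mathbb R)$ $$\|\mathbb P w-\mathbb P z\|\le\|w-z\| ,$$ where $\|\cdot\|$ is the norm of $L^2([0,T];\mathbb R)$. -/

import Mathlib

open MeasureTheory ProbabilityTheory Filter Topology Set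
open scoped NNReal ENNReal

noncomputable section

namespace StochControl

/-- The Hilbert space `L²([0,T]; ℝ)` of (deterministic) controls. -/
abbrev ControlSpace (T : ℝ) : Type :=
  Lp ℝ 2 ((volume : Measure ℝ).restrict (Icc 0 T))

section Ito

variable {Ω : Type*} {mΩ : MeasurableSpace Ω}

/-- A simple process `∑_{i<n} ξ_i 1_{(t_i, t_{i+1}]}`, where `0 ≤ t_0 ≤ t_1 ≤ ⋯` and `ξ_i` is a
bounded, `𝓕_{t_i}`-measurable random variable. -/
structure SimpleProcess (𝓕 : Filtration ℝ≥0 mΩ) where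
  /-- the number of intervals -/
  n : ℕ
  /-- the partition times -/
  time : ℕ → ℝ≥0
  mono : Monotone time
  /-- the values on the intervals -/
  coeff : ℕ → Ω → ℝ
  adapted : ∀ i, StronglyMeasurable[𝓕 (time i)] (coeff i)
  bounded : ∃ C : ℝ, ∀ i ω, |coeff i ω| ≤ C

variable {𝓕 : Filtration ℝ≥0 mΩ}

/-- The value of a simple process at time `t`. -/
def SimpleProcess.eval (S : SimpleProcess 𝓕) (t : ℝ) (ω : Ω) : ℝ :=
  ∑ i ∈ Finset.range S.n,
    (Ioc (S.time i : ℝ) (S.time (i + 1) : ℝ)).indicator (fun _ => S.coeff i ω) t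

/-- The elementary stochastic integral `∫_0^t S dW` of a simple process. -/
def SimpleProcess.integral (S : SimpleProcess 𝓕) (W : ℝ≥0 → Ω → ℝ) (t : ℝ≥0) (ω : Ω) : ℝ :=
  ∑ i ∈ Finset.range S.n,
    S.coeff i ω * (W (min (S.time (i + 1)) t) ω - W (min (S.time i) t) ω)

/-- `I` is (a version of) the Itô integral process `t ↦ ∫_0^t H dW` on `[0,T]`: for some sequence
of simple processes converging to `H` in `L²([0,T] × Ω)`, the elementary integrals up to time `t`
converge to `I t` in `L²(Ω)` for every `t ∈ [0,T]`. -/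
def IsItoIntegral (𝓕 : Filtration ℝ≥0 mΩ) (W : ℝ≥0 → Ω → ℝ) (P : Measure Ω) (T : ℝ)
    (H I : ℝ → Ω → ℝ) : Prop :=
  AEStronglyMeasurable (Function.uncurry H) ((volume.restrict (Icc 0 T)).prod P) ∧
  (∀ t ∈ Icc (0 : ℝ) T, AEStronglyMeasurable (I t) P) ∧
  ∃ S : ℕ → SimpleProcess 𝓕,
    Tendsto (fun k => eLpNorm (fun p : ℝ × Ω => (S k).eval p.1 p.2 - H p.1 p.2) 2
      ((volume.restrict (Icc 0 T)).prod P)) atTop (𝓝 0) ∧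
    ∀ t ∈ Icc (0 : ℝ) T,
      Tendsto (fun k => eLpNorm (fun ω => (S k).integral W t.toNNReal ω - I t ω) 2 P)
        atTop (𝓝 0)

/-- Membership in `L²_𝓕([0,T] × Ω; ℝ)`: square integrable on `[0,T] × Ω` (hence jointly
measurable) and adapted to the `P`-completed filtration, i.e. each `y t` is `P`-a.e. equal to an
`𝓕_t`-measurable random variable. -/
def IsAdaptedL2 (𝓕 : Filtration ℝ≥0 mΩ) (P : Measure Ω) (T : ℝ) (y : ℝ → Ω → ℝ) : Prop :=
  MemLp (Function.uncurry y) 2 ((volume.restrict (Icc 0 T)).prod P) ∧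
  ∀ t ∈ Icc (0 : ℝ) T, AEStronglyMeasurable[𝓕 t.toNNReal] (y t) P

end Ito

/-- A drift `b(t, y, u) = bY t * y + bU t * u + m t` on `[0,T]` that is affine in the state and the
control, with deterministic coefficients and bounded partial derivatives `bY`, `bU`. -/
structure LinearDrift (T : ℝ) where
  /-- the derivative of the drift in the state -/
  bY : ℝ → ℝ
  /-- the derivative of the drift in the control -/
  bU : ℝ → ℝ
  /-- the inhomogeneity -/
  m : ℝ → ℝ
  measurable_bY : Measurable bY
  measurable_bU : Measurable bU
  integrable_m : IntegrableOn m (Icc 0 T)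
  bounded : ∃ C : ℝ, ∀ t ∈ Icc (0 : ℝ) T, |bY t| + |bU t| ≤ C

/-- `σ(y, u)` is continuously differentiable with bounded partial derivatives. -/
def IsAdmissibleDiffusion (σ : ℝ → ℝ → ℝ) : Prop :=
  ContDiff ℝ 1 (fun p : ℝ × ℝ => σ p.1 p.2) ∧
  ∃ C : ℝ, ∀ y u, |deriv (fun x => σ x u) y| + |deriv (fun v => σ y v) u| ≤ C

variable {T : ℝ}

/-- `y ∈ L²_𝓕([0,T] × Ω; ℝ)` is the state with control `u`, that is, it solves
`dy = (bY y + bU u + m) dt + σ(y, u) dW`, `y_0 = y₀`, on `[0,T]`. -/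
def IsState {Ω : Type*} {mΩ : MeasurableSpace Ω} (𝓕 : Filtration ℝ≥0 mΩ) (W : ℝ≥0 → Ω → ℝ)
    (P : Measure Ω) (b : LinearDrift T) (σ : ℝ → ℝ → ℝ) (y₀ : ℝ) (u : ControlSpace T)
    (y : ℝ → Ω → ℝ) : Prop :=
  IsAdaptedL2 𝓕 P T y ∧
  ∃ I : ℝ → Ω → ℝ, IsItoIntegral 𝓕 W P T (fun t ω => σ (y t ω) (u t)) I ∧
    ∀ t ∈ Icc (0 : ℝ) T, ∀ᵐ ω ∂P,
      y t ω = y₀ + (∫ s in (0 : ℝ)..t, (b.bY s * y s ω + b.bU s * u s + b.m s)) + I t ω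

/-- `ψ` solves the backward equation `-dψ = (1 + ψ bY) dt`, `ψ(T) = 0`, on `[0,T]`. -/
def IsPsi (b : LinearDrift T) (ψ : ℝ → ℝ) : Prop :=
  ContinuousOn ψ (Icc 0 T) ∧
  ∀ t ∈ Icc (0 : ℝ) T, ψ t = ∫ s in t..T, (1 + ψ s * b.bY s)

/-- `φ` solves the forward equation `dφ = (bY φ + bU² ψ) dt`, `φ(0) = 0`, on `[0,T]`. -/
def IsPhi (b : LinearDrift T) (ψ φ : ℝ → ℝ) : Prop :=
  ContinuousOn φ (Icc 0 T) ∧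
  ∀ t ∈ Icc (0 : ℝ) T, φ t = ∫ s in (0 : ℝ)..t, (b.bY s * φ s + b.bU s ^ 2 * ψ s)

theorem memLp_psi_mul_bU (b : LinearDrift T) {ψ : ℝ → ℝ} (hψ : IsPsi b ψ) :
    MemLp (fun t => ψ t * b.bU t) 2 ((volume : Measure ℝ).restrict (Icc 0 T)) := by
  obtain ⟨C, hC⟩ := b.bounded
  obtain ⟨D, hD⟩ := isCompact_Icc.exists_bound_of_continuousOn hψ.1
  refine MemLp.of_bound
    ((hψ.1.aestronglyMeasurable measurableSet_Icc).mul b.measurable_bU.aestronglyMeasurable)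
    (D * C) ?_
  refine (ae_restrict_iff' measurableSet_Icc).2 (Eventually.of_forall fun t ht => ?_)
  rw [norm_mul]
  have h1 := hD t ht
  have h2 : ‖b.bU t‖ ≤ C := by
    have := hC t ht
    have := abs_nonneg (b.bY t)
    rw [Real.norm_eq_abs]
    linarith
  exact mul_le_mul h1 h2 (norm_nonneg _) ((norm_nonneg _).trans h1)

/-- The multiplier `μ = max (E[∫_0^T y_t dt] - δ, 0) / (ρ ∫_0^T φ(t) dt)` for the state `y`. -/
def multiplier {Ω : Type*} {mΩ : MeasurableSpace Ω} (P : Measure Ω) (T ρ δ : ℝ) (φ : ℝ → ℝ)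
    (y : ℝ → Ω → ℝ) : ℝ :=
  max ((∫ ω, (∫ t in (0 : ℝ)..T, y t ω) ∂P) - δ) 0 / (ρ * ∫ t in (0 : ℝ)..T, φ t)

/-- The explicit projection `w ↦ w - ρ μ ψ bU`, where `μ` is the multiplier computed from the
state `y` with control `w`. -/
def explicitProjection {Ω : Type*} {mΩ : MeasurableSpace Ω} (P : Measure Ω) (ρ δ : ℝ)
    (b : LinearDrift T) {ψ : ℝ → ℝ} (hψ : IsPsi b ψ) (φ : ℝ → ℝ) (w : ControlSpace T)
    (y : ℝ → Ω → ℝ) : ControlSpace T :=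
  w - (ρ * multiplier P T ρ δ φ y) • (memLp_psi_mul_bU b hψ).toLp (fun t => ψ t * b.bU t)

end StochControl

end

namespace StochControl

/-! Itô integrals have mean zero, so the mean of the state solves a linear equation in which `σ` no
longer appears. Put `g = ψ bU`. Duality with the backward equation of `ψ` turns the expected time
integral of the state into `c + ⟨g, u⟩`, with `c` independent of `u`
(`IsState.expectation_integral_eq`). The same duality applied to `φ` gives `∫ φ = ‖g‖²`
(`LinearDrift.integral_phi`). After `ρ` cancels, the map is `w ↦ w - (max (c - δ + ⟨g, w⟩) 0 / ‖g‖²)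
g`. For `g ≠ 0` this is the metric projection onto a half-space, hence nonexpansive; for `g = 0` it
is the identity. -/

theorem norm_halfSpaceProjection_sub_le {E : Type*} [NormedAddCommGroup E] [InnerProductSpace ℝ E]
    (g x y : E) (a : ℝ) :
    ‖(x - (max (a + inner ℝ g x) 0 / ‖g‖ ^ 2) • g)
        - (y - (max (a + inner ℝ g y) 0 / ‖g‖ ^ 2) • g)‖ ≤ ‖x - y‖ := by
  rcases eq_or_ne g 0 with rfl | hg
  · simp
  have hN : 0 < ‖g‖ ^ 2 := by positivity
  set A := a + inner ℝ g x with hA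
  set B := a + inner ℝ g y with hB
  set N := ‖g‖ ^ 2 with hNdef
  have hAB : inner ℝ (x - y) g = A - B := by
    rw [real_inner_comm, inner_sub_right, hA, hB]; ring
  -- The positive part is monotone and 1-Lipschitz, hence firmly nonexpansive. This lets the cross
  -- term dominate the quadratic term when the squared norm is expanded.
  have hmono : (max A 0 - max B 0) ^ 2 ≤ (max A 0 - max B 0) * (A - B) := by
    rcases le_total A 0 with h1 | h1 <;> rcases le_total B 0 with h2 | h2 <;>
      simp only [max_eq_left, max_eq_right, h1, h2] <;> nlinarith
  have heq : (x - (max A 0 / N) • g) - (y - (max B 0 / N) • g)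
      = (x - y) - ((max A 0 - max B 0) / N) • g := by
    rw [sub_div, sub_smul]; abel
  rw [heq]
  refine le_of_sq_le_sq ?_ (norm_nonneg _)
  rw [norm_sub_sq_real, inner_smul_right, norm_smul, mul_pow, hAB, ← hNdef, Real.norm_eq_abs,
    sq_abs, div_pow]
  have h1 : (max A 0 - max B 0) ^ 2 / N ^ 2 * N = (max A 0 - max B 0) ^ 2 / N := by
    field_simp
  have h2 : (max A 0 - max B 0) ^ 2 / N ≤ (max A 0 - max B 0) / N * (A - B) := by
    rw [div_mul_eq_mul_div]; gcongr
  have h3 : 0 ≤ (max A 0 - max B 0) ^ 2 / N := by positivity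
  rw [h1]
  linarith

/-- Integration by parts for the absolutely continuous primitives of `f` from `a` and of `g` from
`b`: each boundary term vanishes because one factor does. As `f` and `g` are only integrable,
derivatives exist only almost everywhere. -/
theorem integral_mul_integral_tail {f g : ℝ → ℝ} {a b : ℝ} (hf : IntervalIntegrable f volume a b)
    (hg : IntervalIntegrable g volume a b) :
    ∫ t in a..b, f t * ∫ s in t..b, g s = ∫ t in a..b, (∫ s in a..t, f s) * g t := by
  have hF := hf.absolutelyContinuousOnInterval_intervalIntegral (c := a) (by simp)
  have hG := hg.absolutelyContinuousOnInterval_intervalIntegral (c := b) (by simp)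
  have h := hF.integral_deriv_mul_eq_sub hG
  have hFc := hF.continuousOn
  have hGc := hG.continuousOn
  have h' : ∫ t in a..b, (f t * (∫ s in b..t, g s) + (∫ s in a..t, f s) * g t) = 0 := by
    rw [← intervalIntegral.integral_congr_ae (g := fun t =>
      f t * (∫ s in b..t, g s) + (∫ s in a..t, f s) * g t) (μ := volume) (a := a) (b := b)
      (f := fun x => deriv (fun x => ∫ s in a..x, f s) x * (∫ s in b..x, g s)
        + (∫ s in a..x, f s) * deriv (fun x => ∫ s in b..x, g s) x)]
    · rw [h]; simp
    · filter_upwards [hf.ae_hasDerivAt_integral, hg.ae_hasDerivAt_integral] with t h1 h2 ht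
      rw [(h1 (uIoc_subset_uIcc ht) a (by simp)).deriv,
        (h2 (uIoc_subset_uIcc ht) b (by simp)).deriv]
  rw [intervalIntegral.integral_add (hf.mul_continuousOn hGc) (hg.continuousOn_mul hFc)] at h'
  have h3 : ∫ t in a..b, f t * ∫ s in t..b, g s = -∫ t in a..b, f t * ∫ s in b..t, g s := by
    rw [← intervalIntegral.integral_neg]
    refine intervalIntegral.integral_congr fun t _ => ?_
    rw [intervalIntegral.integral_symm t b]; ring
  rw [h3]; linarith

/-! ### Duality between the forward and backward linear equations -/

namespace LinearDrift

variable {T : ℝ} (b : LinearDrift T)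

theorem exists_ae_bound_bY :
    ∃ C : ℝ, ∀ᵐ t ∂((volume : Measure ℝ).restrict (Icc 0 T)), ‖b.bY t‖ ≤ C := by
  obtain ⟨C, hC⟩ := b.bounded
  refine ⟨C, (ae_restrict_iff' measurableSet_Icc).2 (Eventually.of_forall fun t ht => ?_)⟩
  have := hC t ht
  have := abs_nonneg (b.bU t)
  rw [Real.norm_eq_abs]; linarith

theorem exists_ae_bound_bU :
    ∃ C : ℝ, ∀ᵐ t ∂((volume : Measure ℝ).restrict (Icc 0 T)), ‖b.bU t‖ ≤ C := by
  obtain ⟨C, hC⟩ := b.bounded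
  refine ⟨C, (ae_restrict_iff' measurableSet_Icc).2 (Eventually.of_forall fun t ht => ?_)⟩
  have := hC t ht
  have := abs_nonneg (b.bY t)
  rw [Real.norm_eq_abs]; linarith

theorem integrableOn_bY_mul {x : ℝ → ℝ} (hx : IntegrableOn x (Icc 0 T)) :
    IntegrableOn (fun t => b.bY t * x t) (Icc 0 T) := by
  obtain ⟨C, hC⟩ := b.exists_ae_bound_bY
  exact Integrable.bdd_mul hx b.measurable_bY.aestronglyMeasurable hC

theorem integrableOn_bU_mul {x : ℝ → ℝ} (hx : IntegrableOn x (Icc 0 T)) :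
    IntegrableOn (fun t => b.bU t * x t) (Icc 0 T) := by
  obtain ⟨C, hC⟩ := b.exists_ae_bound_bU
  exact Integrable.bdd_mul hx b.measurable_bU.aestronglyMeasurable hC

/-- Duality between the linear equation `dx = (bY x + h) dt` and the backward equation of `ψ`. -/
theorem integral_eq_of_linear_equation (hT : 0 ≤ T) {ψ x h : ℝ → ℝ} {x₀ : ℝ} (hψ : IsPsi b ψ)
    (hx : IntegrableOn x (Icc 0 T)) (hh : IntegrableOn h (Icc 0 T))
    (hxe : ∀ t ∈ Icc (0 : ℝ) T, x t = x₀ + ∫ s in (0 : ℝ)..t, (b.bY s * x s + h s)) :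
    ∫ t in (0 : ℝ)..T, x t = x₀ * ψ 0 + ∫ t in (0 : ℝ)..T, ψ t * h t := by
  have key : ∀ {f : ℝ → ℝ}, IntegrableOn f (Icc 0 T) → IntervalIntegrable f volume 0 T :=
    fun hf => (intervalIntegrable_iff_integrableOn_Icc_of_le hT).2 hf
  have hψc : ContinuousOn ψ (uIcc 0 T) := by rw [uIcc_of_le hT]; exact hψ.1
  have hψi : IntegrableOn ψ (Icc 0 T) := hψ.1.integrableOn_Icc
  have hg : IntervalIntegrable (fun s => 1 + ψ s * b.bY s) volume 0 T := by
    refine (intervalIntegrable_const).add ?_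
    simpa only [mul_comm] using key (b.integrableOn_bY_mul hψi)
  have hf : IntervalIntegrable (fun s => b.bY s * x s + h s) volume 0 T :=
    (key (b.integrableOn_bY_mul hx)).add (key hh)
  -- The tail integral of `1 + ψ bY` is `ψ` and the primitive of `bY x + h` is `x - x₀`. The term `∫
  -- ψ bY x` then appears on both sides and cancels.
  have h1 := integral_mul_integral_tail hf hg
  have h2 : ∫ t in (0 : ℝ)..T, (b.bY t * x t + h t) * ∫ s in t..T, (1 + ψ s * b.bY s)
      = (∫ t in (0 : ℝ)..T, ψ t * (b.bY t * x t)) + ∫ t in (0 : ℝ)..T, ψ t * h t := by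
    rw [← intervalIntegral.integral_add ((key (b.integrableOn_bY_mul hx)).continuousOn_mul hψc)
      ((key hh).continuousOn_mul hψc)]
    refine intervalIntegral.integral_congr fun t ht => ?_
    rw [uIcc_of_le hT] at ht
    rw [← hψ.2 t ht]; ring
  have h3 : ∫ t in (0 : ℝ)..T, (∫ s in (0 : ℝ)..t, (b.bY s * x s + h s)) * (1 + ψ t * b.bY t)
      = (∫ t in (0 : ℝ)..T, x t) + (∫ t in (0 : ℝ)..T, ψ t * (b.bY t * x t)) - x₀ * ψ 0 := by
    rw [hψ.2 0 ⟨le_rfl, hT⟩, ← intervalIntegral.integral_const_mul,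
      ← intervalIntegral.integral_add (key hx)
        ((key (b.integrableOn_bY_mul hx)).continuousOn_mul hψc),
      ← intervalIntegral.integral_sub ((key hx).add
        ((key (b.integrableOn_bY_mul hx)).continuousOn_mul hψc)) (hg.const_mul x₀)]
    refine intervalIntegral.integral_congr fun t ht => ?_
    rw [uIcc_of_le hT] at ht
    have := hxe t ht
    rw [show ∫ s in (0 : ℝ)..t, (b.bY s * x s + h s) = x t - x₀ by linarith]; ring
  linarith

/-- Duality with `x = φ`, `x₀ = 0`, `h = bU² ψ` leaves `∫ (ψ bU)²`. -/
theorem integral_phi (hT : 0 ≤ T) {ψ φ : ℝ → ℝ} (hψ : IsPsi b ψ) (hφ : IsPhi b ψ φ) :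
    ∫ t in (0 : ℝ)..T, φ t = ‖(memLp_psi_mul_bU b hψ).toLp (fun t => ψ t * b.bU t)‖ ^ 2 := by
  have hh : IntegrableOn (fun s => b.bU s ^ 2 * ψ s) (Icc 0 T) := by
    simpa only [pow_two, mul_assoc] using
      b.integrableOn_bU_mul (b.integrableOn_bU_mul hψ.1.integrableOn_Icc)
  rw [b.integral_eq_of_linear_equation hT (x₀ := 0) hψ hφ.1.integrableOn_Icc hh
    (by simpa using hφ.2), ← real_inner_self_eq_norm_sq, L2.inner_def,
    intervalIntegral.integral_of_le hT, ← integral_Icc_eq_integral_Ioc, zero_mul, zero_add]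
  refine integral_congr_ae ?_
  filter_upwards [(memLp_psi_mul_bU b hψ).coeFn_toLp] with t ht
  rw [ht, real_inner_self_eq_norm_sq, Real.norm_eq_abs, sq_abs]
  ring

end LinearDrift

/-! ### Itô integrals have mean zero -/

section Ito

variable {Ω : Type*} {mΩ : MeasurableSpace Ω} {P : Measure Ω} {W : ℝ≥0 → Ω → ℝ}

/-- The increment is centred and independent of the path up to `s`, so the expectation factorizes.
-/
theorem integral_mul_increment_eq_zero (hW : IsPreBrownianReal W P)
    (hWm : ∀ t, StronglyMeasurable (W t)) {s t : ℝ≥0} (hst : s ≤ t) {ξ : Ω → ℝ}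
    (hξ : StronglyMeasurable[Filtration.natural W hWm s] ξ) :
    ∫ ω, ξ ω * (W t ω - W s ω) ∂P = 0 := by
  have hind : IndepFun ξ (fun ω => W t ω - W s ω) P := by
    have h := (hW.indepFun_shift s).symm
    rw [IndepFun_iff_Indep] at h ⊢
    refine indep_of_indep_of_le_left (indep_of_indep_of_le_right h ?_) ?_
    -- The increment is the coordinate at `t - s` of the path shifted by `s`.
    · have : (fun ω => W t ω - W s ω)
          = (fun f : ℝ≥0 → ℝ => f (t - s)) ∘ (fun ω r => W (s + r) ω - W s ω) := by
        funext ω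
        simp [add_tsub_cancel_of_le hst]
      rw [this, ← MeasurableSpace.comap_comp]
      exact MeasurableSpace.comap_mono (measurable_pi_apply _).comap_le
    · rw [← Filtration.natural_eq_comap W hWm s]
      exact hξ.measurable.comap_le
  rw [hind.integral_fun_mul_eq_mul_integral
    (hξ.mono ((Filtration.natural W hWm).le s)).aestronglyMeasurable
    ((hWm t).sub (hWm s)).aestronglyMeasurable,
    integral_sub (hW.integrable_eval t) (hW.integrable_eval s), hW.integral_eval, hW.integral_eval]
  simp

theorem SimpleProcess.integrable_mul_increment (hW : IsPreBrownianReal W P)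
    {𝓕 : Filtration ℝ≥0 mΩ} (S : SimpleProcess 𝓕) (i : ℕ) (s t : ℝ≥0) :
    Integrable (fun ω => S.coeff i ω * (W t ω - W s ω)) P := by
  obtain ⟨C, hC⟩ := S.bounded
  exact ((hW.integrable_eval t).sub (hW.integrable_eval s)).bdd_mul
    ((S.adapted i).mono (𝓕.le _)).aestronglyMeasurable (Eventually.of_forall (hC i))

theorem SimpleProcess.integrable_integral (hW : IsPreBrownianReal W P)
    {𝓕 : Filtration ℝ≥0 mΩ} (S : SimpleProcess 𝓕) (t : ℝ≥0) :
    Integrable (S.integral W t) P :=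
  integrable_finsetSum _ fun i _ => S.integrable_mul_increment hW i _ _

theorem SimpleProcess.expectation_integral (hW : IsPreBrownianReal W P)
    (hWm : ∀ t, StronglyMeasurable (W t)) (S : SimpleProcess (Filtration.natural W hWm)) (t : ℝ≥0) :
    ∫ ω, S.integral W t ω ∂P = 0 := by
  unfold SimpleProcess.integral
  rw [integral_finsetSum _ fun i _ => S.integrable_mul_increment hW i _ _]
  refine Finset.sum_eq_zero fun i _ => ?_
  rcases le_total (S.time i) t with h | h
  · rw [min_eq_left h]
    exact integral_mul_increment_eq_zero hW hWm (le_min (S.mono i.le_succ) h) (S.adapted i)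
  -- An interval starting after `t` has both endpoints truncated to `t`.
  · simp [min_eq_right h, min_eq_right (h.trans (S.mono i.le_succ))]

theorem IsItoIntegral.integrable [IsProbabilityMeasure P] (hW : IsPreBrownianReal W P)
    {𝓕 : Filtration ℝ≥0 mΩ} {T : ℝ} {H I : ℝ → Ω → ℝ}
    (hI : IsItoIntegral 𝓕 W P T H I) {t : ℝ} (ht : t ∈ Icc (0 : ℝ) T) :
    Integrable (I t) P := by
  obtain ⟨-, hm, S, -, hS⟩ := hI
  obtain ⟨k, hk⟩ := ((hS t ht).eventually (gt_mem_nhds ENNReal.zero_lt_top)).exists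
  have h1 : MemLp (fun ω => (S k).integral W t.toNNReal ω - I t ω) 2 P :=
    ⟨((S k).integrable_integral hW _).aestronglyMeasurable.sub (hm t ht), hk⟩
  have h2 := ((S k).integrable_integral hW t.toNNReal).sub (h1.integrable one_le_two)
  refine h2.congr (Eventually.of_forall fun ω => ?_)
  simp

/-- On a probability space `L²` convergence implies `L¹` convergence, so the zero means of the
elementary integrals pass to the limit. -/
theorem IsItoIntegral.integral_eq_zero [IsProbabilityMeasure P] (hW : IsPreBrownianReal W P)
    (hWm : ∀ t, StronglyMeasurable (W t)) {T : ℝ} {H I : ℝ → Ω → ℝ}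
    (hI : IsItoIntegral (Filtration.natural W hWm) W P T H I) {t : ℝ} (ht : t ∈ Icc (0 : ℝ) T) :
    ∫ ω, I t ω ∂P = 0 := by
  have hint := hI.integrable hW ht
  obtain ⟨-, hm, S, -, hS⟩ := hI
  have h1 : Tendsto (fun k => eLpNorm ((S k).integral W t.toNNReal - I t) 1 P) atTop (𝓝 0) :=
    tendsto_of_tendsto_of_tendsto_of_le_of_le tendsto_const_nhds (hS t ht) (fun _ => zero_le)
      fun k => eLpNorm_le_eLpNorm_of_exponent_le one_le_two
        (((S k).integrable_integral hW _).aestronglyMeasurable.sub (hm t ht))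
  have h2 := tendsto_integral_of_L1' (I t) hint.aestronglyMeasurable
    (Eventually.of_forall fun k => (S k).integrable_integral hW _) h1
  simp only [SimpleProcess.expectation_integral hW hWm] at h2
  exact (tendsto_nhds_unique tendsto_const_nhds h2).symm

end Ito

/-! ### The mean of the state -/

section State

variable {Ω : Type*} {mΩ : MeasurableSpace Ω} {P : Measure Ω} [IsProbabilityMeasure P] {T : ℝ}

theorem IsAdaptedL2.integrable {𝓕 : Filtration ℝ≥0 mΩ} {y : ℝ → Ω → ℝ}
    (hy : IsAdaptedL2 𝓕 P T y) :
    Integrable (Function.uncurry y) ((volume.restrict (Icc 0 T)).prod P) :=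
  hy.1.integrable one_le_two

theorem integrableOn_control (u : ControlSpace T) : IntegrableOn u (Icc 0 T) :=
  (Lp.memLp u).integrable one_le_two

/-- The mean of the state solves the averaged linear equation. -/
theorem IsState.expectation_eq {W : ℝ≥0 → Ω → ℝ} (hW : IsPreBrownianReal W P)
    (hWm : ∀ t, StronglyMeasurable (W t)) {b : LinearDrift T} {σ : ℝ → ℝ → ℝ} {y₀ : ℝ}
    {u : ControlSpace T} {y : ℝ → Ω → ℝ} (hy : IsState (Filtration.natural W hWm) W P b σ y₀ u y)
    {t : ℝ} (ht : t ∈ Icc (0 : ℝ) T) :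
    ∫ ω, y t ω ∂P
      = y₀ + ∫ s in (0 : ℝ)..t, (b.bY s * (∫ ω, y s ω ∂P) + (b.bU s * u s + b.m s)) := by
  obtain ⟨hyL, I, hI, hye⟩ := hy
  have hyi := hyL.integrable
  have hh : IntegrableOn (fun s => b.bU s * u s + b.m s) (Icc 0 T) :=
    (b.integrableOn_bU_mul (integrableOn_control u)).add b.integrable_m
  have hF : Integrable (Function.uncurry fun s ω => b.bY s * y s ω + b.bU s * u s + b.m s)
      ((volume.restrict (Icc 0 T)).prod P) := by
    obtain ⟨C, hC⟩ := b.exists_ae_bound_bY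
    have h1 := hyi.bdd_mul (f := fun p : ℝ × Ω => b.bY p.1) (c := C)
      (b.measurable_bY.comp measurable_fst).aestronglyMeasurable
      (Measure.quasiMeasurePreserving_fst.ae hC)
    refine (h1.add (Integrable.comp_fst hh P)).congr (Eventually.of_forall fun p => ?_)
    simp [Function.uncurry, add_assoc]
  have hsub : uIoc 0 t ⊆ Icc 0 T := by
    rw [uIoc_of_le ht.1]
    exact Ioc_subset_Icc_self.trans (Icc_subset_Icc_right ht.2)
  have hFt : Integrable (Function.uncurry fun s ω => b.bY s * y s ω + b.bU s * u s + b.m s)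
      ((volume.restrict (uIoc 0 t)).prod P) :=
    hF.mono_measure (Measure.prod_mono (Measure.restrict_mono hsub le_rfl) le_rfl)
  have hJ : Integrable
      (fun ω => ∫ s in (0 : ℝ)..t, (b.bY s * y s ω + b.bU s * u s + b.m s)) P := by
    have := hFt.integral_prod_right
    simp_rw [intervalIntegral.integral_of_le ht.1]
    rwa [uIoc_of_le ht.1] at this
  rw [integral_congr_ae (hye t ht),
    integral_add (f := fun ω => y₀ + ∫ s in (0 : ℝ)..t, (b.bY s * y s ω + b.bU s * u s + b.m s))
      ((integrable_const _).add hJ) (hI.integrable hW ht),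
    hI.integral_eq_zero hW hWm ht, integral_add (integrable_const _) hJ,
    ← intervalIntegral_integral_swap hFt]
  simp only [integral_const, probReal_univ, one_smul, add_zero]
  congr 1
  refine intervalIntegral.integral_congr_ae_restrict ?_
  -- Fubini gives integrable slices only for almost every `s`, which is enough under the time
  -- integral.
  have hae : ∀ᵐ s ∂(volume.restrict (Icc 0 T)), Integrable (y s) P := hyi.prod_right_ae
  filter_upwards [ae_restrict_of_ae_restrict_of_subset hsub hae] with s hs
  simp_rw [add_assoc]
  rw [integral_add (hs.const_mul _) (integrable_const _), integral_const_mul]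
  simp

theorem IsState.expectation_integral_eq {W : ℝ≥0 → Ω → ℝ} (hW : IsPreBrownianReal W P)
    (hWm : ∀ t, StronglyMeasurable (W t)) (hT : 0 ≤ T) {b : LinearDrift T} {σ : ℝ → ℝ → ℝ} {y₀ : ℝ}
    {u : ControlSpace T} {y : ℝ → Ω → ℝ} (hy : IsState (Filtration.natural W hWm) W P b σ y₀ u y)
    {ψ : ℝ → ℝ} (hψ : IsPsi b ψ) :
    ∫ ω, (∫ t in (0 : ℝ)..T, y t ω) ∂P = (y₀ * ψ 0 + ∫ t in (0 : ℝ)..T, ψ t * b.m t)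
      + inner ℝ ((memLp_psi_mul_bU b hψ).toLp (fun t => ψ t * b.bU t)) u := by
  have hyi := hy.1.integrable
  have hbu := b.integrableOn_bU_mul (integrableOn_control u)
  have hswap : ∫ ω, (∫ t in (0 : ℝ)..T, y t ω) ∂P = ∫ t in (0 : ℝ)..T, ∫ ω, y t ω ∂P := by
    refine (intervalIntegral_integral_swap (hyi.mono_measure ?_)).symm
    refine Measure.prod_mono (Measure.restrict_mono ?_ le_rfl) le_rfl
    rw [uIoc_of_le hT]
    exact Ioc_subset_Icc_self
  have key : ∀ {f : ℝ → ℝ}, IntegrableOn f (Icc 0 T) →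
      IntervalIntegrable (fun t => ψ t * f t) volume 0 T := fun hf =>
    ((intervalIntegrable_iff_integrableOn_Icc_of_le hT).2 hf).continuousOn_mul
      (by rw [uIcc_of_le hT]; exact hψ.1)
  have hsplit : ∫ t in (0 : ℝ)..T, ψ t * (b.bU t * u t + b.m t)
      = (∫ t in (0 : ℝ)..T, ψ t * (b.bU t * u t)) + ∫ t in (0 : ℝ)..T, ψ t * b.m t := by
    simp_rw [mul_add]
    exact intervalIntegral.integral_add (key hbu) (key b.integrable_m)
  have hinner : inner ℝ ((memLp_psi_mul_bU b hψ).toLp (fun t => ψ t * b.bU t)) u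
      = ∫ t in (0 : ℝ)..T, ψ t * (b.bU t * u t) := by
    rw [L2.inner_def, intervalIntegral.integral_of_le hT, ← integral_Icc_eq_integral_Ioc]
    refine integral_congr_ae ?_
    filter_upwards [(memLp_psi_mul_bU b hψ).coeFn_toLp] with t ht
    rw [ht]
    simp
    ring
  rw [hswap, b.integral_eq_of_linear_equation (x := fun t => ∫ ω, y t ω ∂P) hT hψ hyi.integral_prod_left
    (hbu.add b.integrable_m) (fun t ht => hy.expectation_eq hW hWm ht), hinner]
  simp only [Pi.add_apply]
  rw [hsplit]
  ring

end State

/-- Brings the map to half-space form. If `∫ φ = 0`, division by zero yields `0`, matching the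
convention `μ = 0`. -/
theorem explicitProjection_eq {Ω : Type*} {mΩ : MeasurableSpace Ω} {P : Measure Ω}
    [IsProbabilityMeasure P] {T : ℝ} {W : ℝ≥0 → Ω → ℝ} (hW : IsPreBrownianReal W P)
    (hWm : ∀ t, StronglyMeasurable (W t)) (hT : 0 ≤ T) {b : LinearDrift T} {σ : ℝ → ℝ → ℝ}
    {y₀ ρ : ℝ} (δ : ℝ) (hρ : ρ ≠ 0) {ψ φ : ℝ → ℝ} (hψ : IsPsi b ψ) (hφ : IsPhi b ψ φ)
    {u : ControlSpace T} {y : ℝ → Ω → ℝ}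
    (hy : IsState (Filtration.natural W hWm) W P b σ y₀ u y) :
    explicitProjection P ρ δ b hψ φ u y
      = u - (max ((y₀ * ψ 0 + (∫ t in (0 : ℝ)..T, ψ t * b.m t) - δ)
          + inner ℝ ((memLp_psi_mul_bU b hψ).toLp (fun t => ψ t * b.bU t)) u) 0
          / ‖(memLp_psi_mul_bU b hψ).toLp (fun t => ψ t * b.bU t)‖ ^ 2)
        • (memLp_psi_mul_bU b hψ).toLp (fun t => ψ t * b.bU t) := by
  unfold explicitProjection multiplier
  rw [hy.expectation_integral_eq hW hWm hT hψ, b.integral_phi hT hψ hφ, ← mul_div_assoc,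
    mul_div_mul_left _ _ hρ, add_sub_right_comm]

end StochControl

theorem mainTheorem3 {Ω : Type*} {mΩ : MeasurableSpace Ω} (P : Measure Ω) [IsProbabilityMeasure P]
    (W : ℝ≥0 → Ω → ℝ) (hW : IsBrownianReal W P) (hWm : ∀ t, StronglyMeasurable (W t))
    (T : ℝ) (hT : 0 < T) (b : StochControl.LinearDrift T) (σ : ℝ → ℝ → ℝ)
    (hσ : StochControl.IsAdmissibleDiffusion σ) (y₀ δ ρ : ℝ) (hρ : 0 < ρ)
    (ψ φ : ℝ → ℝ) (hψ : StochControl.IsPsi b ψ) (hφ : StochControl.IsPhi b ψ φ)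
    (w z : StochControl.ControlSpace T) (yw yz : ℝ → Ω → ℝ)
    (hw : StochControl.IsState (Filtration.natural W hWm) W P b σ y₀ w yw)
    (hz : StochControl.IsState (Filtration.natural W hWm) W P b σ y₀ z yz) :
    ‖StochControl.explicitProjection P ρ δ b hψ φ w yw
        - StochControl.explicitProjection P ρ δ b hψ φ z yz‖ ≤ ‖w - z‖ := by
  have hWp := hW.toIsPreBrownianReal
  rw [StochControl.explicitProjection_eq hWp hWm hT.le δ hρ.ne' hψ hφ hw,
    StochControl.explicitProjection_eq hWp hWm hT.le δ hρ.ne' hψ hφ hz]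
  exact StochControl.norm_halfSpaceProjection_sub_le _ _ _ _
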